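/- Let $\kappa$ be an inaccessible cardinal (that is, an uncountable regular strong limit cardinal). The following are equivalent: 1. $\kappa$ is weakly compact, i.e. $\kappa$ is uncountable and $\kappa\to(\kappa)^2_2$: for every colouring of the two-element subsets of a set of size $\kappa$ with two colours there is a subset of size $\kappa$ all of whose two-element subsets have the same colour; 2. every $(\kappa,\kappa)$-connected graph has a $K_\kappa$ minor. Here graphs are simple and of arbitrary cardinality. A graph is $(\kappa,\kappa)$-connected if after the removal of any set of fewer than $\kappa$ vertices the number of connected components of the remaining graph is non-zero and less than $\kappa$. The graph $K_\kappa$ is the complete graph on $\kappa$ vertices, and a graph $H$ has a $K_\kappa$ minor if there are pairwise disjoint non-empty sets $(X_\alpha)_{\alpha<\kappa}$ of vertices of $H$, each inducing a connected subgraph of $H$, such that for all $\alpha\neq\beta$ there is an edge of $H$ between $X_\alpha$ and $X_\beta$. -/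

import Mathlib

universe u v

open Cardinal

/-- `κ` is weakly compact: it is uncountable and satisfies the partition relation `κ → (κ)²₂`,
that is, for every colouring of the two-element subsets of a set of size `κ` with two colours,
there is a homogeneous subset of size `κ`. (The values of `c` on the diagonal of `Sym2 α` play no
role.) -/
def Cardinal.IsWeaklyCompact (κ : Cardinal.{u}) : Prop :=
  ℵ₀ < κ ∧ ∀ α : Type u, #α = κ → ∀ c : Sym2 α → Fin 2,
    ∃ (H : Set α) (i : Fin 2), #H = κ ∧ ∀ x ∈ H, ∀ y ∈ H, x ≠ y → c s(x, y) = i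

namespace SimpleGraph

/-- `G` is a minor of `H`: there are pairwise disjoint non-empty vertex sets `X u` of `H`, indexed
by the vertices of `G`, each inducing a connected subgraph of `H`, such that whenever `u` and `v`
are adjacent in `G` there is an edge of `H` between `X u` and `X v`. -/
def IsMinor {V : Type u} {W : Type v} (G : SimpleGraph V) (H : SimpleGraph W) : Prop :=
  ∃ X : V → Set W,
    (∀ u, (X u).Nonempty) ∧
    (∀ u v, u ≠ v → Disjoint (X u) (X v)) ∧
    (∀ u, (H.induce (X u)).Connected) ∧
    ∀ u v, G.Adj u v → ∃ x ∈ X u, ∃ y ∈ X v, H.Adj x y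

/-- The complete graph `K_κ` on `κ` vertices. -/
def completeOfCard (κ : Cardinal.{u}) : SimpleGraph κ.out := ⊤

/-- `G` is `(κ, μ)`-connected: after the removal of any set of fewer than `κ` vertices, the number
of connected components is non-zero and less than `μ`. -/
def IsCardConnected {V : Type u} (G : SimpleGraph V) (κ μ : Cardinal.{u}) : Prop :=
  ∀ S : Set V, #S < κ →
    #(G.induce Sᶜ).ConnectedComponent ≠ 0 ∧ #(G.induce Sᶜ).ConnectedComponent < μ

end SimpleGraph

/-! ### Regular cardinals and the partition relation. -/

namespace Cardinal

variable {κ : Cardinal.{u}}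

/-! Forward: closing off under finite paths (`IsCardConnected.exists_injective`) reduces to a graph
on `κ` whose final segments all have fewer than `κ` components. Colouring pairs by lexicographic
order yields an unbounded set that each component eventually contains or avoids; it selects a
coherent component `C s` of every final segment (`exists_isDirection`). A closure-point argument
puts in each `C s` a vertex adjacent to all later `C t` (`IsDirection.exists_dominating`). Bounded
connected pieces around such vertices, taken sparsely, are the branch sets.

Backward: the comparability graph of the Erdős–Rado tree of a 2-colouring is `(κ, κ)`-connected,
since strong limitness keeps its levels small. The least elements of the branch sets of a `K_κ`
minor form a chain of size `κ`. On a chain the colour of a pair depends only on its smaller element,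
so pigeonhole gives a homogeneous set. -/

theorem mk_Iio_ord_lt (s : κ.ord.ToType) : #(Set.Iio s) < κ := by
  simpa using mk_Iio_lt s (by simp)

theorem IsRegular.exists_gt_of_mk_lt (hκ : κ.IsRegular) {S : Set κ.ord.ToType} (hS : #S < κ) :
    ∃ b, ∀ x ∈ S, x < b := by
  by_contra! h
  have h1 : IsCofinal S := fun b => by
    obtain ⟨x, hx, hb⟩ := h b
    exact ⟨x, hx, hb⟩
  have h2 := Order.cof_le h1
  rw [Ordinal.cof_toType, hκ.cof_ord] at h2
  exact absurd hS (not_lt.2 h2)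

theorem IsRegular.exists_gt_of_family (hκ : κ.IsRegular) {J : Type u} (hJ : #J < κ)
    (f : J → κ.ord.ToType) : ∃ b, ∀ j, f j < b := by
  obtain ⟨b, hb⟩ := hκ.exists_gt_of_mk_lt (S := Set.range f) (mk_range_le.trans_lt hJ)
  exact ⟨b, fun j => hb _ ⟨j, rfl⟩⟩

theorem IsRegular.exists_gt_pair (hκ : κ.IsRegular) (a b : κ.ord.ToType) :
    ∃ c, a < c ∧ b < c := by
  have : NoMaxOrder κ.ord.ToType := noMaxOrder hκ.1
  obtain ⟨c, hc⟩ := exists_gt (max a b)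
  exact ⟨c, (le_max_left _ _).trans_lt hc, (le_max_right _ _).trans_lt hc⟩

theorem exists_ge_of_mk_eq {H : Set κ.ord.ToType} (hH : #H = κ) (a : κ.ord.ToType) :
    ∃ h ∈ H, a ≤ h := by
  by_contra! h
  exact absurd (hH ▸ (mk_le_mk_of_subset (show H ⊆ Set.Iio a from h)).trans_lt
    (mk_Iio_ord_lt a)) (lt_irrefl _)

/-- A sequence of functions which is monotone for the lexicographic order is eventually constant
in every coordinate. -/
theorem IsRegular.eventually_const_of_lex (hκ : κ.IsRegular) {H : Set κ.ord.ToType}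
    (f : κ.ord.ToType → κ.ord.ToType → Bool)
    (hf : (∀ x ∈ H, ∀ y ∈ H, x < y → toLex (f x) ≤ toLex (f y)) ∨
      (∀ x ∈ H, ∀ y ∈ H, x < y → toLex (f y) ≤ toLex (f x))) (δ : κ.ord.ToType) :
    ∃ b, ∀ x ∈ H, ∀ y ∈ H, b ≤ x → b ≤ y → f x δ = f y δ := by
  induction δ using WellFoundedLT.induction with
  | ind δ ih =>
  have : Nonempty κ.ord.ToType := ⟨δ⟩
  choose! b hb using ih
  obtain ⟨c, hc⟩ := hκ.exists_gt_of_family (J := Set.Iio δ) (mk_Iio_ord_lt δ)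
    (fun j => b j)
  -- Beyond `c` all coordinates before `δ` are frozen, so lexicographic comparison forces comparison
  -- at `δ`.
  have key : ∀ x ∈ H, ∀ y ∈ H, c ≤ x → c ≤ y → toLex (f x) ≤ toLex (f y) → f x δ ≤ f y δ := by
    intro x hx y hy hcx hcy hle
    by_contra hlt
    refine absurd hle (not_le.2 ⟨δ, fun j hj => ?_, not_le.1 hlt⟩)
    exact hb j hj y hy x hx ((hc ⟨j, hj⟩).le.trans hcy) ((hc ⟨j, hj⟩).le.trans hcx)
  have mono : ∀ v : Bool, (∀ x ∈ H, ∀ y ∈ H, c ≤ x → x < y → f x δ = v → f y δ = v) →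
      ∃ b, ∀ x ∈ H, ∀ y ∈ H, b ≤ x → b ≤ y → f x δ = f y δ := by
    intro v hv
    by_cases h : ∃ x ∈ H, c ≤ x ∧ f x δ = v
    · obtain ⟨x, hx, hcx, hxv⟩ := h
      have : ∀ y ∈ H, x ≤ y → f y δ = v := fun y hy hxy => by
        rcases hxy.eq_or_lt with rfl | hlt
        · exact hxv
        · exact hv x hx y hy hcx hlt hxv
      exact ⟨x, fun y hy z hz hxy hxz => (this y hy hxy).trans (this z hz hxz).symm⟩
    · push Not at h
      refine ⟨c, fun y hy z hz hcy hcz => ?_⟩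
      have h1 := h y hy hcy
      have h2 := h z hz hcz
      cases hv' : v <;> simp_all
  rcases hf with hf | hf
  · refine mono true fun x hx y hy hcx hxy hxv => ?_
    have := key x hx y hy hcx (hcx.trans hxy.le) (hf x hx y hy hxy)
    rw [hxv] at this
    exact top_le_iff.1 this
  · refine mono false fun x hx y hy hcx hxy hxv => ?_
    have := key y hy x hx (hcx.trans hxy.le) hcx (hf x hx y hy hxy)
    rw [hxv] at this
    exact le_bot_iff.1 this

/-- A weakly compact cardinal `κ` carries, for any `κ` many subsets, an unbounded set which is
eventually contained in, or eventually disjoint from, each of them. -/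
theorem IsWeaklyCompact.exists_eventually_decided (hw : κ.IsWeaklyCompact) (hκ : κ.IsRegular)
    {J : Type u} (hJ : #J = κ) (A : J → Set κ.ord.ToType) :
    ∃ H : Set κ.ord.ToType, (∀ a, ∃ h ∈ H, a ≤ h) ∧
      ∀ j, ∃ b, ∀ x ∈ H, ∀ y ∈ H, b ≤ x → b ≤ y → (x ∈ A j ↔ y ∈ A j) := by
  classical
  obtain ⟨e⟩ : Nonempty (κ.ord.ToType ≃ J) := Cardinal.eq.1 (by rw [hJ, mk_ord_toType])
  set f : κ.ord.ToType → κ.ord.ToType → Bool := fun x δ => decide (x ∈ A (e δ)) with hf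
  -- Sierpiński-style colouring: does the lexicographic order of the membership vectors agree with
  -- the order of the indices?
  obtain ⟨H, i, hH, hi⟩ := hw.2 κ.ord.ToType (mk_ord_toType κ)
    (fun p => if toLex (f p.inf) ≤ toLex (f p.sup) then 1 else 0)
  refine ⟨H, exists_ge_of_mk_eq hH, fun j => ?_⟩
  have := hκ.eventually_const_of_lex (H := H) f ?_ (e.symm j)
  · simpa [hf] using this
  · by_cases h1 : i = 1
    · refine Or.inl fun x hx y hy hxy => ?_
      have := hi x hx y hy hxy.ne
      simp only [Sym2.inf_mk, Sym2.sup_mk, inf_eq_left.2 hxy.le, sup_eq_right.2 hxy.le] at this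
      by_contra hcon
      rw [if_neg hcon, h1] at this
      exact absurd this (by decide)
    · refine Or.inr fun x hx y hy hxy => ?_
      have := hi x hx y hy hxy.ne
      simp only [Sym2.inf_mk, Sym2.sup_mk, inf_eq_left.2 hxy.le, sup_eq_right.2 hxy.le] at this
      by_contra hcon
      rw [if_pos (not_le.1 hcon).le] at this
      exact h1 this.symm

/-- Every function `g` on a regular cardinal admits a sequence which grows faster than `g`. -/
theorem IsRegular.exists_sparse (hκ : κ.IsRegular) (g : κ.ord.ToType → κ.ord.ToType) :
    ∃ h : κ.ord.ToType → κ.ord.ToType, ∀ α β, α < β → g (h α) < h β := by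
  have hb : ∀ β (f : ∀ α, α < β → κ.ord.ToType), ∃ b, ∀ α (hα : α < β), g (f α hα) < b :=
    fun β f => by
      obtain ⟨b, hb⟩ := hκ.exists_gt_of_family (J := Set.Iio β) (mk_Iio_ord_lt β)
        (fun α => g (f α α.2))
      exact ⟨b, fun α hα => hb ⟨α, hα⟩⟩
  choose B hB using hb
  refine ⟨WellFoundedLT.fix B, fun α β hαβ => ?_⟩
  rw [WellFoundedLT.fix_eq B β]
  exact hB β (fun γ _ => WellFoundedLT.fix B γ) α hαβ

/-- Every function on a regular uncountable cardinal has arbitrarily large closure points. -/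
theorem IsRegular.exists_closed_point (hκ : κ.IsRegular) (hω : ℵ₀ < κ)
    (g : κ.ord.ToType → κ.ord.ToType) (a : κ.ord.ToType) :
    ∃ s, a < s ∧ ∀ x < s, g x < s := by
  have hb : ∀ t, ∃ t', t < t' ∧ ∀ x < t, g x < t' := fun t => by
    obtain ⟨b, hb⟩ := hκ.exists_gt_of_family (J := Set.Iio t) (mk_Iio_ord_lt t)
      (fun α => g α)
    obtain ⟨c, hc, hc'⟩ := hκ.exists_gt_pair b t
    exact ⟨c, hc', fun x hx => (hb ⟨x, hx⟩).trans hc⟩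
  choose B hB hB' using hb
  let t : ℕ → κ.ord.ToType := fun n => B^[n] a
  have ht : ∀ n, t (n + 1) = B (t n) := fun n => Function.iterate_succ_apply' B n a
  obtain ⟨c, hc⟩ := hκ.exists_gt_of_family (J := ULift.{u} ℕ) (by simpa using hω)
    (fun n => t n.down)
  have hne : {s | ∀ n, t n ≤ s}.Nonempty := ⟨c, fun n => (hc ⟨n⟩).le⟩
  -- `s` is the supremum of the iterates `t n`, which exists because `κ` has uncountable cofinality.
  obtain ⟨s, hs, hmin⟩ := WellFounded.has_min (wellFounded_lt (α := κ.ord.ToType)) _ hne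
  refine ⟨s, (hB a).trans_le (hs 1), fun x hx => ?_⟩
  obtain ⟨n, hn⟩ : ∃ n, x < t n := by
    by_contra! h
    exact hmin x h hx
  refine (hB' _ x hn).trans_le ?_
  rw [← ht]
  exact hs _

end Cardinal

/-! ### Directions, dominating vertices and the minor on `κ`. -/

namespace SimpleGraph

/-- The spanning subgraph of `G` consisting of the edges with both ends in `A`. -/
def keep {V : Type*} (G : SimpleGraph V) (A : Set V) : SimpleGraph V where
  Adj a b := G.Adj a b ∧ a ∈ A ∧ b ∈ A
  symm := ⟨fun _ _ h => ⟨h.1.symm, h.2.2, h.2.1⟩⟩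
  loopless := ⟨fun _ h => G.loopless.irrefl _ h.1⟩

section Keep

variable {V : Type*} {G : SimpleGraph V}

theorem keep_le (A : Set V) : G.keep A ≤ G := fun _ _ h => h.1

theorem keep_mono {A B : Set V} (h : A ⊆ B) : G.keep A ≤ G.keep B :=
  fun _ _ hab => ⟨hab.1, h hab.2.1, h hab.2.2⟩

theorem Reachable.mem_of_keep {A : Set V} {a b : V} (h : (G.keep A).Reachable a b) (ha : a ∈ A) :
    b ∈ A := by
  rw [reachable_iff_reflTransGen] at h
  induction h with
  | refl => exact ha
  | tail _ h _ => exact h.2.2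

theorem Reachable.exists_finite_keep {A : Set V} {a b : V} (h : (G.keep A).Reachable a b) :
    ∃ F : Set V, F.Finite ∧ a ∈ F ∧ (G.keep (A ∩ F)).Reachable a b := by
  rw [reachable_iff_reflTransGen] at h
  induction h with
  | refl => exact ⟨{a}, Set.finite_singleton a, rfl, Reachable.refl _⟩
  | @tail b c _ hbc ih =>
    obtain ⟨F, hF, ha, hr⟩ := ih
    refine ⟨insert b (insert c F), (hF.insert c).insert b, by simp [ha], ?_⟩
    refine (hr.mono (keep_mono ?_)).trans (Adj.reachable ⟨hbc.1, ⟨hbc.2.1, ?_⟩, ⟨hbc.2.2, ?_⟩⟩)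
    · exact Set.inter_subset_inter_right _
        ((Set.subset_insert _ _).trans (Set.subset_insert _ _))
    · simp
    · simp

end Keep

variable {κ : Cardinal.{u}}

/-- `C s`, for `s` in the index set of an increasing filtration by initial segments, is a
coherent choice of a component of `G` outside the initial segment below `s`. -/
structure IsDirection (G : SimpleGraph κ.ord.ToType) (C : κ.ord.ToType → Set κ.ord.ToType) :
    Prop where
  nonempty : ∀ s, (C s).Nonempty
  le_of_mem : ∀ s, ∀ x ∈ C s, s ≤ x
  reachable : ∀ s, ∀ x ∈ C s, ∀ y ∈ C s, (G.keep (Set.Ici s)).Reachable x y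
  closed : ∀ s, ∀ x ∈ C s, ∀ y, (G.keep (Set.Ici s)).Reachable x y → y ∈ C s
  anti : ∀ s t, s ≤ t → C t ⊆ C s

theorem exists_isDirection (hw : κ.IsWeaklyCompact) (hκ : κ.IsRegular)
    (G : SimpleGraph κ.ord.ToType)
    (hG : ∀ s, ∃ R : Set κ.ord.ToType, #R < κ ∧
      ∀ v, s ≤ v → ∃ r ∈ R, (G.keep (Set.Ici s)).Reachable v r) :
    ∃ C, G.IsDirection C := by
  obtain ⟨H, hH, hdec⟩ := hw.exists_eventually_decided hκ
    (J := κ.ord.ToType × κ.ord.ToType) (by simp [mul_eq_self hκ.1])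
    (fun p => {x | (G.keep (Set.Ici p.1)).Reachable x p.2})
  -- `C s` is the component containing a tail of `H`. It is nonempty because the fewer than `κ`
  -- representatives in `R` share a bound beyond which membership of `H` in their components is
  -- decided.
  refine ⟨fun s => {x | s ≤ x ∧ ∃ b, ∀ h ∈ H, b ≤ h → (G.keep (Set.Ici s)).Reachable x h},
    fun s => ?_, fun s x hx => hx.1, ?_, ?_, ?_⟩
  · obtain ⟨R, hR, hR'⟩ := hG s
    choose b hb using fun r => hdec (s, r)
    obtain ⟨c, hc⟩ := hκ.exists_gt_of_family hR (fun r => b r)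
    obtain ⟨h, hh, hle⟩ := hH (max s c)
    obtain ⟨r, hr, hr'⟩ := hR' h ((le_max_left _ _).trans hle)
    refine ⟨h, (le_max_left _ _).trans hle, b r, fun h' hh' hbh' => ?_⟩
    exact hr'.trans ((hb r h hh h' hh' (((hc ⟨r, hr⟩).le.trans (le_max_right _ _)).trans hle)
      hbh').1 hr').symm
  · rintro s x ⟨-, b, hb⟩ y ⟨-, c, hc⟩
    obtain ⟨h, hh, hle⟩ := hH (max b c)
    exact (hb h hh ((le_max_left _ _).trans hle)).trans
      (hc h hh ((le_max_right _ _).trans hle)).symm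
  · rintro s x ⟨hsx, b, hb⟩ y hxy
    exact ⟨hxy.mem_of_keep hsx, b, fun h hh hle => hxy.symm.trans (hb h hh hle)⟩
  · rintro s t hst x ⟨htx, b, hb⟩
    exact ⟨hst.trans htx, b, fun h hh hle =>
      (hb h hh hle).mono (keep_mono (Set.Ici_subset_Ici.2 hst))⟩

/-- The vertices which have a neighbour in `C s` for all `s` beyond them. -/
def dominating (G : SimpleGraph κ.ord.ToType) (C : κ.ord.ToType → Set κ.ord.ToType) :
    Set κ.ord.ToType :=
  {d | ∀ s, d < s → ∃ x ∈ C s, G.Adj d x}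

/-- Otherwise let `g d` witness the failure of each `d ∈ C s₀`. At a closure point `s` of `g`, no
vertex of `C s₀` below `s` has a neighbour in `C s`, so a path starting in `C s` never leaves it,
yet some vertex of `C s₀` below `s` is reachable. -/
theorem IsDirection.exists_dominating {G : SimpleGraph κ.ord.ToType}
    {C : κ.ord.ToType → Set κ.ord.ToType} (hC : G.IsDirection C) (hκ : κ.IsRegular)
    (hω : ℵ₀ < κ) (s₀ : κ.ord.ToType) : ∃ d ∈ C s₀, d ∈ G.dominating C := by
  by_contra! hcon
  have hg : ∀ d, ∃ s, d ∈ C s₀ → ∀ x ∈ C s, ¬ G.Adj d x := fun d => by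
    by_cases hd : d ∈ C s₀
    · have := hcon d hd
      simp only [dominating, Set.mem_ofPred_eq, not_forall, not_exists, not_and] at this
      obtain ⟨s, -, hs⟩ := this
      exact ⟨s, fun _ => hs⟩
    · exact ⟨d, fun h => absurd h hd⟩
  choose g hg using hg
  obtain ⟨d, hd⟩ := hC.nonempty s₀
  obtain ⟨s, hs, hclosed⟩ := hκ.exists_closed_point hω g (max s₀ d)
  have hs₀ : s₀ ≤ s := ((le_max_left _ _).trans_lt hs).le
  obtain ⟨x, hx⟩ := hC.nonempty s
  have hxd := hC.reachable s₀ x (hC.anti _ _ hs₀ hx) d hd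
  have hds : d ∈ C s := by
    clear hd hs
    rw [reachable_iff_reflTransGen] at hxd
    induction hxd with
    | refl => exact hx
    | @tail y z _ hyz hy =>
      have hz : z ∈ C s₀ := hC.closed s₀ y (hC.anti _ _ hs₀ hy) z hyz.reachable
      rcases lt_or_ge z s with hlt | hge
      · exact absurd hyz.1.symm (hg z hz y (hC.anti _ _ (hclosed z hlt).le hy))
      · exact hC.closed s y hy z (Adj.reachable ⟨hyz.1, hC.le_of_mem s y hy, hge⟩)
  exact absurd (hC.le_of_mem s d hds) (not_le.2 ((le_max_right _ _).trans_lt hs))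

/-- Each of the fewer than `κ` earlier dominating vertices has a neighbour joined to `d` by a finite
path in the final segment; regularity bounds all these paths at once. -/
theorem IsDirection.exists_bounded_connected {G : SimpleGraph κ.ord.ToType}
    {C : κ.ord.ToType → Set κ.ord.ToType} (hC : G.IsDirection C) (hκ : κ.IsRegular)
    (hω : ℵ₀ < κ) (s : κ.ord.ToType) :
    ∃ (b d : κ.ord.ToType) (Y : Set κ.ord.ToType), Y ⊆ Set.Ico s b ∧ (G.induce Y).Connected ∧
      d ∈ Y ∧ d ∈ G.dominating C ∧ ∀ e ∈ G.dominating C, e < s → ∃ x ∈ Y, G.Adj e x := by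
  obtain ⟨d, hd, hdom⟩ := hC.exists_dominating hκ hω s
  have hb : ∀ e, ∃ b, d < b ∧ (e ∈ G.dominating C → e < s →
      ∃ x, G.Adj e x ∧ (G.keep (Set.Ico s b)).Reachable d x) := fun e => by
    by_cases he : e ∈ G.dominating C ∧ e < s
    · obtain ⟨x, hx, hex⟩ := he.1 s he.2
      obtain ⟨F, hF, -, hr⟩ := (hC.reachable s d hd x hx).exists_finite_keep
      obtain ⟨b, hb⟩ := hκ.exists_gt_of_mk_lt ((mk_lt_aleph0_iff.2 hF).trans hω)
      obtain ⟨c, hc, hc'⟩ := hκ.exists_gt_pair b d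
      refine ⟨c, hc', fun _ _ => ⟨x, hex, hr.mono (keep_mono ?_)⟩⟩
      exact fun y hy => ⟨hy.1, (hb y hy.2).trans hc⟩
    · obtain ⟨c, hc, -⟩ := hκ.exists_gt_pair d d
      exact ⟨c, hc, fun h1 h2 => absurd ⟨h1, h2⟩ he⟩
  choose b hdb hb using hb
  obtain ⟨c, hc⟩ := hκ.exists_gt_of_family (mk_Iio_ord_lt s) (fun e => b e)
  obtain ⟨c', hc', hdc'⟩ := hκ.exists_gt_pair c d
  have hmem : d ∈ Set.Ico s c' := ⟨hC.le_of_mem s d hd, hdc'⟩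
  refine ⟨c', d, ((G.keep (Set.Ico s c')).connectedComponentMk d).supp, ?_, ?_, rfl, hdom, ?_⟩
  · intro y hy
    exact (ConnectedComponent.exact hy).symm.mem_of_keep hmem
  · exact (ConnectedComponent.connected_toSimpleGraph _).mono
      (comap_monotone _ (keep_le _))
  · intro e he hes
    obtain ⟨x, hex, hr⟩ := hb e he hes
    refine ⟨x, ConnectedComponent.sound (hr.mono (keep_mono ?_)).symm, hex⟩
    exact Set.Ico_subset_Ico_right (((hc ⟨e, hes⟩).trans hc').le)

/-- A graph on a weakly compact cardinal in which the complement of each initial segment has few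
components has a large complete minor. -/
theorem exists_top_minor_of_isWeaklyCompact (hw : κ.IsWeaklyCompact) (hκ : κ.IsRegular)
    (G : SimpleGraph κ.ord.ToType)
    (hG : ∀ s, ∃ R : Set κ.ord.ToType, #R < κ ∧
      ∀ v, s ≤ v → ∃ r ∈ R, (G.keep (Set.Ici s)).Reachable v r) :
    (⊤ : SimpleGraph κ.ord.ToType).IsMinor G := by
  obtain ⟨C, hC⟩ := exists_isDirection hw hκ G hG
  choose b d Y hY hconn hd hdom hadj using hC.exists_bounded_connected hκ hw.1
  obtain ⟨h, hh⟩ := hκ.exists_sparse b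
  have hlt : ∀ α β, α < β → Disjoint (Y (h α)) (Y (h β)) ∧
      ∃ x ∈ Y (h α), ∃ y ∈ Y (h β), G.Adj x y := fun α β hαβ => by
    refine ⟨Set.disjoint_left.2 fun x hx hx' => ?_, d (h α), hd _, hadj (h β) _ (hdom _) ?_⟩
    · exact absurd ((hY _ hx).2.trans (hh α β hαβ)) (not_lt.2 (hY _ hx').1)
    · exact (hY _ (hd _)).2.trans (hh α β hαβ)
  refine ⟨fun α => Y (h α), fun α => ⟨_, hd _⟩, fun α β hαβ => ?_, fun α => hconn _,
    fun α β hαβ => ?_⟩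
  · rcases lt_or_gt_of_ne hαβ with hl | hl
    · exact (hlt _ _ hl).1
    · exact (hlt _ _ hl).1.symm
  · rcases lt_or_gt_of_ne hαβ.ne with hl | hl
    · exact (hlt _ _ hl).2
    · obtain ⟨x, hx, y, hy, hxy⟩ := (hlt _ _ hl).2
      exact ⟨y, hy, x, hx, hxy.symm⟩

end SimpleGraph

/-! ### Reduction to graphs of size `κ`. -/

namespace SimpleGraph

theorem IsMinor.of_comap {U : Type*} {V : Type u} {W : Type v} {K : SimpleGraph V}
    {G : SimpleGraph W} {j : U → W} (hj : Function.Injective j) (h : K.IsMinor (G.comap j)) :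
    K.IsMinor G := by
  obtain ⟨X, hne, hdis, hconn, hadj⟩ := h
  refine ⟨fun u => j '' X u, fun u => (hne u).image j, fun u v huv => ?_, fun u => ?_,
    fun u v huv => ?_⟩
  · exact (Set.disjoint_image_iff hj).2 (hdis u v huv)
  · let φ : (G.comap j).induce (X u) →g G.induce (j '' X u) :=
      ⟨fun x => ⟨j x, x, x.2, rfl⟩, fun h => h⟩
    refine (hconn u).map φ ?_
    rintro ⟨_, x, hx, rfl⟩
    exact ⟨⟨x, hx⟩, rfl⟩
  · obtain ⟨x, hx, y, hy, hxy⟩ := hadj u v huv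
    exact ⟨j x, ⟨x, hx, rfl⟩, j y, ⟨y, hy, rfl⟩, hxy⟩

theorem IsMinor.of_embedding {U : Type*} {V : Type u} {W : Type v} {K : SimpleGraph U}
    {L : SimpleGraph V} {G : SimpleGraph W} (φ : L ↪g K) (h : K.IsMinor G) : L.IsMinor G := by
  obtain ⟨X, hne, hdis, hconn, hadj⟩ := h
  exact ⟨fun u => X (φ u), fun u => hne _, fun u v huv => hdis _ _ (φ.injective.ne huv),
    fun u => hconn _, fun u v huv => hadj _ _ (φ.map_rel_iff.2 huv)⟩

variable {κ : Cardinal.{u}} {V : Type u} {G : SimpleGraph V}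

theorem IsCardConnected.exists_notMem {μ : Cardinal.{u}} (h : G.IsCardConnected κ μ) {S : Set V}
    (hS : #S < κ) : ∃ z, z ∉ S := by
  obtain ⟨c⟩ := mk_ne_zero_iff.1 (h S hS).1
  induction c using ConnectedComponent.ind with
  | h v => exact ⟨v, v.2⟩

theorem IsCardConnected.exists_representatives {μ : Cardinal.{u}} (h : G.IsCardConnected κ μ)
    {S : Set V} (hS : #S < κ) :
    ∃ R : Set V, #R < μ ∧ ∀ v, v ∉ S → ∃ r ∈ R, (G.keep Sᶜ).Reachable v r := by
  refine ⟨Set.range fun c : (G.induce Sᶜ).ConnectedComponent => (c.nonempty_supp.some : V),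
    mk_range_le.trans_lt (h S hS).2, fun v hv => ⟨_, ⟨connectedComponentMk _ ⟨v, hv⟩, rfl⟩, ?_⟩⟩
  let φ : G.induce Sᶜ →g G.keep Sᶜ := ⟨Subtype.val, fun {a b} h => ⟨h, a.2, b.2⟩⟩
  have : (G.induce Sᶜ).Reachable ⟨v, hv⟩
      (connectedComponentMk (G.induce Sᶜ) ⟨v, hv⟩).nonempty_supp.some :=
    (ConnectedComponent.exact (connectedComponentMk _ _).nonempty_supp.some_mem).symm
  exact this.map φ

theorem Reachable.exists_comap {U : Type*} {j : U → V} {A : Set V} (hA : A ⊆ Set.range j)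
    {B : Set U} (hB : ∀ x, j x ∈ A → x ∈ B) {x : U} {w : V} (h : (G.keep A).Reachable (j x) w) :
    ∃ y, j y = w ∧ ((G.comap j).keep B).Reachable x y := by
  rw [reachable_iff_reflTransGen] at h
  induction h with
  | refl => exact ⟨x, rfl, Reachable.refl _⟩
  | @tail b c _ hbc ih =>
    obtain ⟨y, rfl, hy⟩ := ih
    obtain ⟨z, rfl⟩ := hA hbc.2.2
    exact ⟨z, rfl, hy.trans (Adj.reachable ⟨hbc.1, hB _ hbc.2.1, hB _ hbc.2.2⟩)⟩

/-- There is a sequence `W` of small vertex sets, each of which contains, for each earlier member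
`S` of the sequence, the vertex `z S` and the sets `P S v` for all `v` in earlier members. -/
theorem exists_closed_chain (hκ : κ.IsRegular) (hω : ℵ₀ < κ) (P : Set V → V → Set V) (z : Set V → V)
    (hP : ∀ S v, (P S v).Finite) :
    ∃ W : κ.ord.ToType → Set V, (∀ β, #(W β) < κ) ∧ (∀ γ β, γ < β → z (W γ) ∈ W β) ∧
      ∀ γ₁ γ₂ β, γ₁ < β → γ₂ < β → ∀ v ∈ W γ₂, P (W γ₁) v ⊆ W β := by
  let B : ∀ β : κ.ord.ToType, (∀ γ, γ < β → Set V) → Set V := fun β f =>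
    (⋃ γ : Set.Iio β, {z (f γ γ.2)}) ∪
      ⋃ p : Set.Iio β × Set.Iio β, ⋃ v ∈ f p.2 p.2.2, P (f p.1 p.1.2) v
  have hfix : ∀ β, WellFoundedLT.fix B β = B β (fun γ _ => WellFoundedLT.fix B γ) :=
    fun β => WellFoundedLT.fix_eq B β
  have hfin : ∀ s : Set V, s.Finite → #s < κ := fun s hs => (mk_lt_aleph0_iff.2 hs).trans hω
  refine ⟨WellFoundedLT.fix B, fun β => ?_, fun γ β hγβ => ?_, fun γ₁ γ₂ β h₁ h₂ v hv => ?_⟩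
  · induction β using WellFoundedLT.induction with
    | ind β ih =>
    rw [hfix]
    refine (mk_union_le _ _).trans_lt (add_lt_of_lt hκ.1 ?_ ?_)
    · refine (card_iUnion_lt_iff_forall_of_isRegular hκ (mk_Iio_ord_lt β)).2 fun γ => ?_
      exact hfin _ (Set.finite_singleton _)
    · refine (card_iUnion_lt_iff_forall_of_isRegular hκ ?_).2 fun p => ?_
      · rw [← mul_def]
        exact mul_lt_of_lt hκ.1 (mk_Iio_ord_lt β) (mk_Iio_ord_lt β)
      · exact (card_biUnion_lt_iff_forall_of_isRegular hκ (ih _ p.2.2)).2 fun v _ =>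
          hfin _ (hP _ _)
  · rw [hfix]
    exact Or.inl (Set.mem_iUnion.2 ⟨⟨γ, hγβ⟩, rfl⟩)
  · rw [hfix β]
    refine fun x hx => Or.inr (Set.mem_iUnion.2 ⟨(⟨γ₁, h₁⟩, ⟨γ₂, h₂⟩), ?_⟩)
    exact Set.mem_iUnion₂.2 ⟨v, hv, hx⟩

/-- A `(κ, κ)`-connected graph has an induced subgraph of size `κ` in which the complement of each
initial segment has few components. -/
theorem IsCardConnected.exists_injective (h : G.IsCardConnected κ κ) (hκ : κ.IsRegular)
    (hω : ℵ₀ < κ) : ∃ j : κ.ord.ToType → V, Function.Injective j ∧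
      ∀ s, ∃ R : Set κ.ord.ToType, #R < κ ∧
        ∀ v, s ≤ v → ∃ r ∈ R, ((G.comap j).keep (Set.Ici s)).Reachable v r := by
  have hz : ∀ S : Set V, ∃ z, #S < κ → z ∉ S := fun S => by
    by_cases hS : #S < κ
    · obtain ⟨z, hz⟩ := h.exists_notMem hS
      exact ⟨z, fun _ => hz⟩
    · obtain ⟨z, -⟩ := h.exists_notMem (S := ∅) (by simpa using hκ.pos)
      exact ⟨z, fun h => absurd h hS⟩
  choose z hz using hz
  have hR : ∀ S : Set V, ∃ R : Set V, #S < κ →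
      #R < κ ∧ ∀ v, v ∉ S → ∃ r ∈ R, (G.keep Sᶜ).Reachable v r := fun S => by
    by_cases hS : #S < κ
    · obtain ⟨R, hR⟩ := h.exists_representatives hS
      exact ⟨R, fun _ => hR⟩
    · exact ⟨∅, fun h => absurd h hS⟩
  choose R hR using hR
  have hP : ∀ (S : Set V) v, ∃ F : Set V, F.Finite ∧ v ∈ F ∧ (#S < κ → v ∉ S →
      ∃ r ∈ R S, (G.keep (Sᶜ ∩ F)).Reachable v r) := fun S v => by
    by_cases hS : #S < κ ∧ v ∉ S
    · obtain ⟨r, hr, hvr⟩ := (hR S hS.1).2 v hS.2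
      obtain ⟨F, hF, hv, hvr⟩ := hvr.exists_finite_keep
      exact ⟨F, hF, hv, fun _ _ => ⟨r, hr, hvr⟩⟩
    · exact ⟨{v}, Set.finite_singleton v, rfl, fun h1 h2 => absurd ⟨h1, h2⟩ hS⟩
  -- `P S v` carries a path avoiding `S` from `v` to a representative of its component.
  choose P hPfin hPmem hP using hP
  obtain ⟨W, hW, hzW, hPW⟩ := exists_closed_chain hκ hω P z hPfin
  have hmono : ∀ γ β, γ ≤ β → W γ ⊆ W β := fun γ β hγβ v hv => by
    rcases hγβ.eq_or_lt with rfl | hlt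
    · exact hv
    · exact hPW γ γ β hlt hlt v hv (hPmem _ _)
  have hzlt : ∀ γ β, γ < β → z (W γ) ≠ z (W β) := fun γ β hlt heq =>
    hz _ (hW β) (heq ▸ hzW γ β hlt)
  have hcard : #(⋃ β, W β : Set V) = κ := by
    apply le_antisymm
    · refine (mk_iUnion_le _).trans ?_
      rw [mk_ord_toType]
      exact (mul_le_mul_right (ciSup_le' fun β => (hW β).le) κ).trans (mul_eq_self hκ.1).le
    · have hinj : Function.Injective fun γ : κ.ord.ToType =>
          (⟨z (W γ), by
            obtain ⟨c, hc, -⟩ := hκ.exists_gt_pair γ γ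
            exact Set.mem_iUnion.2 ⟨c, hzW γ c hc⟩⟩ : (⋃ β, W β : Set V)) := by
        intro γ β hγβ
        have hγβ' : z (W γ) = z (W β) := congrArg Subtype.val hγβ
        rcases lt_trichotomy γ β with hl | he | hl
        · exact absurd hγβ' (hzlt _ _ hl)
        · exact he
        · exact absurd hγβ'.symm (hzlt _ _ hl)
      exact (mk_ord_toType κ).symm.le.trans (mk_le_of_injective hinj)
  obtain ⟨e⟩ : Nonempty (κ.ord.ToType ≃ (⋃ β, W β : Set V)) :=
    Cardinal.eq.1 (by rw [hcard, mk_ord_toType])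
  have hinj : Function.Injective fun x => (e x : V) := Subtype.val_injective.comp e.injective
  refine ⟨fun x => e x, hinj, fun s => ?_⟩
  have hlevel : ∀ x, ∃ β, (e x : V) ∈ W β := fun x => Set.mem_iUnion.1 (e x).2
  choose l hl using hlevel
  -- `W a` swallows all vertices with index below `s`, so paths avoiding `W a` stay in the final
  -- segment at `s`.
  obtain ⟨a, ha⟩ := hκ.exists_gt_of_family (mk_Iio_ord_lt s) (fun x => l x)
  have hpre : ∀ T : Set V, #T < κ → #((fun x => (e x : V)) ⁻¹' T) < κ := fun T hT =>
    (mk_preimage_of_injective _ T hinj).trans_lt hT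
  refine ⟨(fun x => (e x : V)) ⁻¹' (R (W a) ∪ W a), hpre _ ((mk_union_le _ _).trans_lt
    (add_lt_of_lt hκ.1 (hR _ (hW a)).1 (hW a))), fun v hv => ?_⟩
  by_cases hva : (e v : V) ∈ W a
  · exact ⟨v, Or.inr hva, Reachable.refl _⟩
  · obtain ⟨r, hr, hvr⟩ := hP _ _ (hW a) hva
    obtain ⟨b, hb, hb'⟩ := hκ.exists_gt_pair a (l v)
    have hrange : (W a)ᶜ ∩ P (W a) (e v) ⊆ Set.range fun x => (e x : V) := fun w hw =>
      have := Set.mem_iUnion.2 ⟨b, hPW a (l v) b hb hb' _ (hl v) hw.2⟩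
      ⟨e.symm ⟨w, this⟩, by simp⟩
    have hIci : ∀ x, (e x : V) ∈ (W a)ᶜ ∩ P (W a) (e v) → x ∈ Set.Ici s := fun x hx =>
      Set.mem_Ici.2 <| not_lt.1 fun hlt => hx.1 (hmono _ _ (ha ⟨x, Set.mem_Iio.2 hlt⟩).le (hl x))
    obtain ⟨y, hyr, hy⟩ := hvr.exists_comap (j := fun x => (e x : V)) hrange hIci
    exact ⟨y, Or.inl (show (e y : V) ∈ R (W a) from hyr ▸ hr), hy⟩

theorem completeOfCard_isMinor_iff {W : Type*} {H : SimpleGraph W} :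
    (completeOfCard κ).IsMinor H ↔ (⊤ : SimpleGraph κ.ord.ToType).IsMinor H := by
  obtain ⟨e⟩ : Nonempty (κ.out ≃ κ.ord.ToType) :=
    Cardinal.eq.1 (by rw [mk_out, mk_ord_toType])
  exact ⟨fun h => h.of_embedding (Embedding.completeGraph e.symm.toEmbedding),
    fun h => h.of_embedding (Embedding.completeGraph e.toEmbedding)⟩

end SimpleGraph

/-! ### The Erdős–Rado tree and the converse. -/

namespace Cardinal

variable {ι : Type u} [LinearOrder ι] [WellFoundedLT ι] {X : Type*}

/-- The Erdős–Rado tree order of a colouring `c` of the pairs of a well-ordered set: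
`ErdosRado c β γ` means that `γ` lies strictly below `β` in the tree. -/
def ErdosRado (c : Sym2 ι → X) (β : ι) : ι → Prop :=
  WellFoundedLT.fix fun γ P => γ < β ∧ ∀ δ (h : δ < γ), P δ h → c s(δ, γ) = c s(δ, β)

variable {c : Sym2 ι → X}

theorem erdosRado_iff {β γ : ι} : ErdosRado c β γ ↔
    γ < β ∧ ∀ δ < γ, ErdosRado c β δ → c s(δ, γ) = c s(δ, β) := by
  unfold ErdosRado
  rw [WellFoundedLT.fix_eq]

theorem ErdosRado.lt {β γ : ι} (h : ErdosRado c β γ) : γ < β := (erdosRado_iff.1 h).1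

/-- Points tree-below `β` and less than `γ` have the same colour with `γ` as with `β`, so the
recursions for `γ` and `β` coincide below `γ`. -/
theorem ErdosRado.iff_of_lt {β γ : ι} (h : ErdosRado c β γ) (δ : ι) (hδ : δ < γ) :
    ErdosRado c γ δ ↔ ErdosRado c β δ := by
  induction δ using WellFoundedLT.induction with
  | ind δ ih =>
  rw [erdosRado_iff, erdosRado_iff (β := β)]
  refine and_congr (iff_of_true hδ (hδ.trans h.lt)) (forall_congr' fun ε => forall_congr' fun hε =>
    ?_)
  rw [ih ε hε (hε.trans hδ)]
  refine forall_congr' fun hε' => ?_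
  rw [(erdosRado_iff.1 h).2 ε (hε.trans hδ) hε']

theorem ErdosRado.trans {α β γ : ι} (h : ErdosRado c α β) (h' : ErdosRado c β γ) :
    ErdosRado c α γ := (h.iff_of_lt γ h'.lt).1 h'

theorem ErdosRado.total {α β γ : ι} (hβ : ErdosRado c α β) (hγ : ErdosRado c α γ) :
    β = γ ∨ ErdosRado c β γ ∨ ErdosRado c γ β := by
  rcases lt_trichotomy β γ with h | h | h
  · exact Or.inr (Or.inr ((hγ.iff_of_lt β h).2 hβ))
  · exact Or.inl h
  · exact Or.inr (Or.inl ((hβ.iff_of_lt γ h).2 hγ))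

/-- The comparability graph of the Erdős–Rado tree. -/
def erdosRadoGraph (c : Sym2 ι → X) : SimpleGraph ι where
  Adj a b := ErdosRado c a b ∨ ErdosRado c b a
  symm := ⟨fun _ _ h => h.symm⟩
  loopless := ⟨fun _ h => h.elim (fun h => h.lt.ne rfl) (fun h => h.lt.ne rfl)⟩

/-- A connected set in the comparability graph of the Erdős–Rado tree has a least element. -/
theorem exists_least_of_connected {Y : Set ι} (hne : Y.Nonempty)
    (hY : ((erdosRadoGraph c).induce Y).Connected) :
    ∃ m ∈ Y, ∀ y ∈ Y, y = m ∨ ErdosRado c y m := by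
  obtain ⟨m, hm, hmin⟩ := WellFounded.has_min (wellFounded_lt (α := ι)) Y hne
  refine ⟨m, hm, fun y hy => ?_⟩
  have hr := hY.preconnected ⟨m, hm⟩ ⟨y, hy⟩
  rw [SimpleGraph.reachable_iff_reflTransGen] at hr
  suffices ∀ w : Y, Relation.ReflTransGen ((erdosRadoGraph c).induce Y).Adj ⟨m, hm⟩ w →
      (w : ι) = m ∨ ErdosRado c w m from this _ hr
  intro w hw
  induction hw with
  | refl => exact Or.inl rfl
  | @tail a b _ hab ih =>
    have hab' : ErdosRado c a b ∨ ErdosRado c b a := hab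
    have hbm : ¬ ErdosRado c m b := fun h => hmin b b.2 h.lt
    rcases ih with ih | ih
    · rw [ih] at hab'
      exact Or.inr (hab'.resolve_left hbm)
    · rcases hab' with h | h
      · rcases h.total ih with h | h | h
        · exact Or.inl h
        · exact Or.inr h
        · exact absurd h hbm
      · exact Or.inr (h.trans ih)

/-- A complete minor in the comparability graph of the Erdős–Rado tree gives a chain of the same
size. -/
theorem exists_chain_of_minor {V : Type u}
    (h : (⊤ : SimpleGraph V).IsMinor (erdosRadoGraph c)) :
    ∃ m : V → ι, Function.Injective m ∧
      ∀ u v, u ≠ v → ErdosRado c (m u) (m v) ∨ ErdosRado c (m v) (m u) := by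
  obtain ⟨X, hne, hdis, hconn, hadj⟩ := h
  choose m hm hleast using fun u => exists_least_of_connected (hne u) (hconn u)
  have hinj : Function.Injective m := fun u v huv => by
    by_contra hne
    exact Set.disjoint_left.1 (hdis u v hne) (hm u) (huv ▸ hm v)
  -- Both `m u` and `m v` lie on the branch ending at `x`, hence are comparable.
  have key : ∀ u v, u ≠ v → ∀ x ∈ X u, ∀ y ∈ X v, ErdosRado c x y →
      ErdosRado c (m u) (m v) ∨ ErdosRado c (m v) (m u) := by
    intro u v huv x hx y hy hxy
    have hv : ErdosRado c x (m v) := by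
      rcases hleast v y hy with rfl | h
      · exact hxy
      · exact hxy.trans h
    rcases hleast u x hx with rfl | h
    · exact Or.inl hv
    · exact (h.total hv).resolve_left (hinj.ne huv)
  refine ⟨m, hinj, fun u v huv => ?_⟩
  obtain ⟨x, hx, y, hy, hxy⟩ := hadj u v huv
  rcases hxy with hxy | hxy
  · exact key u v huv x hx y hy hxy
  · exact (key v u huv.symm y hy x hx hxy).symm

variable {κ : Cardinal.{u}}

/-- The minimal elements of the Erdős–Rado tree outside an initial segment are few. -/
theorem mk_erdosRado_level_lt (hκ : κ.IsInaccessible) (c : Sym2 κ.ord.ToType → Fin 2)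
    (s : κ.ord.ToType) :
    #{m : κ.ord.ToType | s ≤ m ∧ ∀ γ, ErdosRado c m γ → γ < s} < κ := by
  have hlt : #(Set (Set.Iio s) × Set (Set.Iio s)) < κ := by
    rw [← mul_def, mk_set]
    have := hκ.isStrongLimit.isStrongPrelimit (mk_Iio_ord_lt s)
    exact mul_lt_of_lt hκ.isRegular.1 this this
  refine lt_of_le_of_lt ?_ hlt
  let F : {m : κ.ord.ToType | s ≤ m ∧ ∀ γ, ErdosRado c m γ → γ < s} →
      Set (Set.Iio s) × Set (Set.Iio s) :=
    fun m => ({γ | ErdosRado c m γ}, {γ | c s((γ : κ.ord.ToType), (m : κ.ord.ToType)) = 0})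
  -- All tree predecessors of `m'` are below `s`; equal colours there would put `m` tree-below `m'`,
  -- although `s ≤ m`.
  have key : ∀ m m', F m = F m' → ¬ (m : κ.ord.ToType) < m' := by
    intro m m' hF hlt
    refine absurd (m'.2.2 m (erdosRado_iff.2 ⟨hlt, fun δ _ hδ => ?_⟩)) (not_lt.2 m.2.1)
    have h1 := Set.ext_iff.1 (Prod.ext_iff.1 hF).2 ⟨δ, m'.2.2 δ hδ⟩
    change c s(δ, (m : κ.ord.ToType)) = 0 ↔ c s(δ, (m' : κ.ord.ToType)) = 0 at h1
    omega
  refine mk_le_of_injective (f := F) fun m m' hF => Subtype.ext ?_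
  exact le_antisymm (not_lt.1 (key m' m hF.symm)) (not_lt.1 (key m m' hF))

theorem isCardConnected_erdosRadoGraph (hκ : κ.IsInaccessible) (c : Sym2 κ.ord.ToType → Fin 2) :
    (erdosRadoGraph c).IsCardConnected κ κ := by
  intro S hS
  obtain ⟨s, hs⟩ := hκ.isRegular.exists_gt_of_mk_lt hS
  refine ⟨mk_ne_zero_iff.2 ⟨SimpleGraph.connectedComponentMk _ ⟨s, fun h => (hs s h).ne rfl⟩⟩, ?_⟩
  set L := {m : κ.ord.ToType | s ≤ m ∧ ∀ γ, ErdosRado c m γ → γ < s} with hL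
  have hsmall : #(Set.Iio s ∪ L : Set κ.ord.ToType) < κ := (mk_union_le _ _).trans_lt
    (add_lt_of_lt hκ.isRegular.1 (mk_Iio_ord_lt s) (mk_erdosRado_level_lt hκ c s))
  have hsmall' : #((Subtype.val : (Sᶜ : Set κ.ord.ToType) → κ.ord.ToType) ⁻¹'
      (Set.Iio s ∪ L)) < κ :=
    (mk_preimage_of_injective _ _ Subtype.val_injective).trans_lt hsmall
  refine lt_of_le_of_lt (mk_le_of_surjective (f := fun v : (Subtype.val : (Sᶜ : Set κ.ord.ToType) →
    κ.ord.ToType) ⁻¹' (Set.Iio s ∪ L) => SimpleGraph.connectedComponentMk _ v.1) ?_) hsmall'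
  intro C
  induction C using SimpleGraph.ConnectedComponent.ind with
  | h v =>
  obtain ⟨v, hv⟩ := v
  rcases lt_or_ge v s with hlt | hge
  · exact ⟨⟨⟨v, hv⟩, Or.inl hlt⟩, rfl⟩
  -- The first point from `s` onwards on the branch to `v` belongs to `L` and is `v` or adjacent to
  -- it, so `L` and `Set.Iio s` meet every component.
  obtain ⟨m, ⟨hsm, hm⟩, hmin⟩ := WellFounded.has_min (wellFounded_lt (α := κ.ord.ToType))
    {m | s ≤ m ∧ (m = v ∨ ErdosRado c v m)} ⟨v, hge, Or.inl rfl⟩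
  have hmS : m ∉ S := fun h => (hs m h).not_ge hsm
  have hmL : m ∈ L := ⟨hsm, fun γ hγ => not_le.1 fun hsγ => hmin γ ⟨hsγ, Or.inr (by
    rcases hm with rfl | hm
    · exact hγ
    · exact hm.trans hγ)⟩ hγ.lt⟩
  refine ⟨⟨⟨m, hmS⟩, Or.inr hmL⟩, SimpleGraph.ConnectedComponent.sound ?_⟩
  rcases hm with rfl | hm
  · exact SimpleGraph.Reachable.refl _
  · exact SimpleGraph.Adj.reachable (G := (erdosRadoGraph c).induce Sᶜ) (Or.inr hm)

/-- A chain of size `κ` in the Erdős–Rado tree contains a homogeneous set of size `κ`. -/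
theorem exists_homogeneous_of_chain (hκ : κ.IsRegular) (c : Sym2 κ.ord.ToType → Fin 2)
    {B : Set κ.ord.ToType} (hB : #B = κ)
    (hchain : ∀ x ∈ B, ∀ y ∈ B, x < y → ErdosRado c y x) :
    ∃ H ⊆ B, ∃ i, #H = κ ∧ ∀ x ∈ H, ∀ y ∈ H, x ≠ y → c s(x, y) = i := by
  let D : Fin 2 → Set κ.ord.ToType := fun i => {x ∈ B | ∀ y ∈ B, x < y → c s(x, y) = i}
  have hcover : B ⊆ D 0 ∪ D 1 := by
    intro x hx
    obtain ⟨x', hx', -⟩ := hκ.exists_gt_pair x x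
    obtain ⟨y₀, hy₀, hle⟩ := exists_ge_of_mk_eq hB x'
    have hxy₀ := hx'.trans_le hle
    -- Along a chain the colour is determined by the smaller point.
    have : ∀ y ∈ B, x < y → c s(x, y) = c s(x, y₀) := fun y hy hxy => by
      rcases lt_trichotomy y y₀ with h | rfl | h
      · exact (erdosRado_iff.1 (hchain y hy y₀ hy₀ h)).2 x hxy (hchain x hx y₀ hy₀ hxy₀)
      · rfl
      · exact ((erdosRado_iff.1 (hchain y₀ hy₀ y hy h)).2 x hxy₀ (hchain x hx y hy hxy)).symm
    by_cases h0 : c s(x, y₀) = 0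
    · exact Or.inl ⟨hx, fun y hy hxy => (this y hy hxy).trans h0⟩
    · exact Or.inr ⟨hx, fun y hy hxy => (this y hy hxy).trans (by omega)⟩
  obtain ⟨i, hi⟩ : ∃ i, #(D i) = κ := by
    by_contra! h
    have hlt : ∀ i, #(D i) < κ := fun i =>
      lt_of_le_of_ne
      ((mk_le_mk_of_subset (show D i ⊆ B from fun x hx => hx.1)).trans_eq hB) (h i)
    exact absurd (hB.symm.trans_le (mk_le_mk_of_subset hcover)) (not_le.2 ((mk_union_le _ _).trans_lt
      (add_lt_of_lt hκ.1 (hlt 0) (hlt 1))))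
  refine ⟨D i, fun x hx => hx.1, i, hi, fun x hx y hy hxy => ?_⟩
  rcases lt_or_gt_of_ne hxy with h | h
  · exact hx.2 y hy.1 h
  · rw [Sym2.eq_swap]
    exact hy.2 x hx.1 h

theorem isWeaklyCompact_of_minor (hκ : κ.IsInaccessible)
    (h : ∀ (V : Type u) (G : SimpleGraph V), G.IsCardConnected κ κ →
      (⊤ : SimpleGraph κ.ord.ToType).IsMinor G) : κ.IsWeaklyCompact := by
  refine ⟨(isInaccessible_def.1 hκ).1, fun α hα c => ?_⟩
  obtain ⟨e⟩ : Nonempty (κ.ord.ToType ≃ α) := Cardinal.eq.1 (by rw [hα, mk_ord_toType])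
  let c' : Sym2 κ.ord.ToType → Fin 2 := fun p => c (p.map e)
  obtain ⟨m, hm, hchain⟩ := exists_chain_of_minor
    (h _ _ (isCardConnected_erdosRadoGraph hκ c'))
  obtain ⟨H, -, i, hH, hi⟩ := exists_homogeneous_of_chain hκ.isRegular c' (B := Set.range m)
    (by rw [mk_range_eq m hm, mk_ord_toType]) (by
      rintro _ ⟨u, rfl⟩ _ ⟨v, rfl⟩ huv
      refine (hchain u v fun h => huv.ne (h ▸ rfl)).resolve_left fun h => huv.not_gt h.lt)
  refine ⟨e '' H, i, by rw [mk_image_eq e.injective, hH], ?_⟩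
  rintro _ ⟨x, hx, rfl⟩ _ ⟨y, hy, rfl⟩ hxy
  exact hi x hx y hy fun h => hxy (h ▸ rfl)

end Cardinal

theorem mainTheorem6 (κ : Cardinal.{u}) (hκ : κ.IsInaccessible) :
    κ.IsWeaklyCompact ↔
      ∀ (V : Type u) (G : SimpleGraph V), G.IsCardConnected κ κ →
        (SimpleGraph.completeOfCard κ).IsMinor G := by
  simp only [SimpleGraph.completeOfCard_isMinor_iff]
  refine ⟨fun hw V G hG => ?_, Cardinal.isWeaklyCompact_of_minor hκ⟩
  obtain ⟨j, hj, hrep⟩ := hG.exists_injective hκ.isRegular hw.1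
  exact (SimpleGraph.exists_top_minor_of_isWeaklyCompact hw hκ.isRegular _ hrep).of_comap hj
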